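/- Let $\Lambda$ be a finite discrete alphabet, let $\mathbb N_0=\{0,1,2,\dots\}$, and let $\sigma$ be the shift, $(\sigma x)(i)=x(i+1)$. Let $X$ be a two-sided subshift, i.e. a closed set $X\subset\Lambda^{\mathbb Z}$ with $\sigma(X)=X$ (resp. a one-sided subshift, i.e. a closed set $X\subset\Lambda^{\mathbb N_0}$ with $\sigma(X)\subset X$). Let $\mathcal B^*(X)$ be the set of nonempty finite blocks $x|_{[i,i+k)}$ occurring in elements $x\in X$, let $\mathcal M(X)$ be the set of Borel probability measures on $X$, and let $\mathcal M^{\mathrm{erg}}_\sigma(X)\subset\mathcal M(X)$ be the set of ergodic $\sigma$-invariant ones. For $B\in\mathcal B^*(X)$ of length $k$ and $C\in\Lambda^l$, $l\ge1$, put $B(C)=\frac1k\,|\{0\le i\le k-l: B|_{[i,i+l)}=C\}|$ (which is $0$ if $l>k$), and for $\mu\in\mathcal M(X)$ put $\mu(C)=\mu(\{x\in X: x|_{[0,l)}=C\})$. Equip the disjoint union $\mathcal B^*(X)\cup\mathcal M(X)$ with the topology given by the pseudometric $$d^*(p,q)=\sum_{l=1}^{\infty}2^{-l}\sum_{C\in\Lambda^l}|p(C)-q(C)|.$$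 Let $\mathcal U\subset\mathcal B^*(X)\cup\mathcal M(X)$ be an open set containing $\mathcal M^{\mathrm{erg}}_\sigma(X)$. A block $B\in\mathcal B^*(X)$ is called $\mathcal U$-ergodic if $B\in\mathcal U$. **Theorem.** For every $m\in\mathbb N_0$ and every $x\in X$ there is a representation of $x$ as an infinite concatenation of finite blocks $$x=\dots B_{-2}A_{-2}B_{-1}A_{-1}A_1B_1A_2B_2\dots$$ with $A_1$ starting at the coordinate $0$ (resp. $x=A_1B_1A_2B_2\dots$ if $X$ is one-sided), such that all blocks $B_j$ are $\mathcal U$-ergodic and have lengths at least $m$ (with no upper bound on the lengths), the blocks $A_j$ may be empty, and the set $M\subset\mathbb Z$ (resp. $M\subset\mathbb N_0$) of coordinates covered by the blocks $A_j$ has Banach density $0$, i.e. $$\inf_{N\ge1}\sup_i\frac{|M\cap[i,i+N)|}{N}=\sup_{N\ge1}\inf_i\frac{|M\cap[i,i+N)|}{N}=0,$$ where $i$ ranges over $\mathbb Z$ (resp. $\mathbb N_0$). -/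

import Mathlib

open Set MeasureTheory

noncomputable section

namespace Subshift

/- The index set `I` of the symbolic sequences is `ℤ` (two-sided case) or `ℕ` (one-sided case,
`ℕ` containing `0`); the notions that read the same in both cases are written once for `I`. -/

/-- The shift transformation `(σ x)(i) = x(i+1)`. -/
def shift {Λ I : Type*} [AddMonoidWithOne I] (x : I → Λ) : I → Λ := fun i => x (i + 1)

/-- A two-sided subshift: closed and invariant under the `ℤ`-action generated by the shift. -/
structure IsTwoSided {Λ : Type*} [TopologicalSpace Λ] (X : Set (ℤ → Λ)) : Prop where
  isClosed : IsClosed X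
  image_eq : shift '' X = X

/-- A one-sided subshift: closed and (forward) invariant under the shift. -/
structure IsOneSided {Λ : Type*} [TopologicalSpace Λ] (X : Set (ℕ → Λ)) : Prop where
  isClosed : IsClosed X
  mapsTo : MapsTo shift X X

theorem IsTwoSided.mapsTo {Λ : Type*} [TopologicalSpace Λ] {X : Set (ℤ → Λ)}
    (h : IsTwoSided X) : MapsTo shift X X :=
  fun _ hx => h.image_eq ▸ mem_image_of_mem shift hx

/-- The block `x|_{[i, i+k)}`, as an element of `Λ^k`. -/
def window {Λ I : Type*} [AddMonoidWithOne I] (x : I → Λ) (i : I) (k : ℕ) : Fin k → Λ :=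
  fun j => x (i + ((j : ℕ) : I))

/-- The block `B|_{[i, i+l)}` of a block `B` of length `k`, for `0 ≤ i ≤ k - l`. -/
def subblock {Λ : Type*} {k l : ℕ} (B : Fin k → Λ) (i : Fin (k + 1 - l)) : Fin l → Λ :=
  fun j => B ⟨(i : ℕ) + j, by omega⟩

open Classical in
/-- The frequency `Fr_B(C)` of occurrences of `C` in `B`; it is `0` when `C` is longer
than `B`. -/
def freq {Λ : Type*} {k l : ℕ} (B : Fin k → Λ) (C : Fin l → Λ) : ℝ :=
  ((Finset.univ.filter fun i : Fin (k + 1 - l) => subblock B i = C).card : ℝ) / k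

/-- The (nonempty) blocks occurring in the elements of `X`. -/
def Block {Λ I : Type*} [AddMonoidWithOne I] (X : Set (I → Λ)) : Type _ :=
  {B : Σ k : ℕ, (Fin k → Λ) // 0 < B.1 ∧ ∃ x ∈ X, ∃ i : I, window x i B.1 = B.2}

/-- The disjoint union of the set of blocks occurring in `X` and the set of Borel probability
measures on `X`. -/
inductive BlockOrMeasure {Λ I : Type*} [AddMonoidWithOne I] [MeasurableSpace Λ]
    (X : Set (I → Λ)) : Type _
  | block (B : Block X) : BlockOrMeasure X
  | measure (μ : ProbabilityMeasure X) : BlockOrMeasure X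

/-- The value ascribed to `C ∈ Λ^l`: the frequency `Fr_B(C)` for a block `B`, and the measure
`μ([C])` of the cylinder `[C] = {x ∈ X : x|_{[0,l)} = C}` for a measure `μ`. -/
def BlockOrMeasure.value {Λ I : Type*} [AddMonoidWithOne I] [MeasurableSpace Λ]
    {X : Set (I → Λ)} {l : ℕ} : BlockOrMeasure X → (Fin l → Λ) → ℝ
  | .block B, C => freq B.1.2 C
  | .measure μ, C => (μ : Measure X).real {x : X | window (x : I → Λ) 0 l = C}

/-- The distance `d*(p,q) = ∑_{l ≥ 1} 2^{-l} ∑_{C ∈ Λ^l} |p(C) - q(C)|` on blocks and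
measures (the summation index below is `l - 1`). -/
def dStar {Λ I : Type*} [Fintype Λ] [AddMonoidWithOne I] [MeasurableSpace Λ]
    {X : Set (I → Λ)} (p q : BlockOrMeasure X) : ℝ :=
  ∑' l : ℕ, (1 / 2 : ℝ) ^ (l + 1) * ∑ C : Fin (l + 1) → Λ, |p.value C - q.value C|

theorem value_nonneg {Λ I : Type*} [AddMonoidWithOne I] [MeasurableSpace Λ]
    {X : Set (I → Λ)} {l : ℕ} (p : BlockOrMeasure X) (C : Fin l → Λ) : 0 ≤ p.value C := by
  cases p with
  | block B => exact div_nonneg (Nat.cast_nonneg _) (Nat.cast_nonneg _)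
  | measure μ => exact measureReal_nonneg

theorem sum_freq_le_one {Λ : Type*} [Fintype Λ] {k : ℕ} (l : ℕ) (B : Fin k → Λ) :
    ∑ C : Fin (l + 1) → Λ, freq B C ≤ 1 := by
  classical
  unfold freq
  rw [← Finset.sum_div, ← Nat.cast_sum]
  refine div_le_one_of_le₀ ?_ (Nat.cast_nonneg _)
  have h := Finset.card_eq_sum_card_fiberwise (s := (Finset.univ : Finset (Fin (k + 1 - (l + 1)))))
    (t := (Finset.univ : Finset (Fin (l + 1) → Λ))) (f := fun i => subblock B i)
    (fun _ _ => Finset.mem_coe.2 (Finset.mem_univ _))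
  have h2 : ∑ C : Fin (l + 1) → Λ, (Finset.univ.filter
      fun i : Fin (k + 1 - (l + 1)) => subblock B i = C).card = k + 1 - (l + 1) := by
    simpa using h.symm
  have h3 : k + 1 - (l + 1) ≤ k := by omega
  exact_mod_cast le_trans (le_of_eq (by convert h2)) h3

theorem sum_value_le_one {Λ I : Type*} [Fintype Λ] [AddMonoidWithOne I] [MeasurableSpace Λ]
    [MeasurableSingletonClass Λ] {X : Set (I → Λ)} (l : ℕ) (p : BlockOrMeasure X) :
    ∑ C : Fin (l + 1) → Λ, p.value C ≤ 1 := by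
  cases p with
  | block B => exact sum_freq_le_one l B.1.2
  | measure μ =>
    have hf : Measurable fun x : X => window (x : I → Λ) 0 (l + 1) :=
      measurable_pi_lambda _ fun j => (measurable_pi_apply _).comp measurable_subtype_coe
    have h := sum_measureReal_preimage_singleton (μ := (μ : Measure X))
      (f := fun x : X => window (x : I → Λ) 0 (l + 1)) Finset.univ
      (fun C _ => hf (measurableSet_singleton C))
    refine le_trans (le_of_eq h) ?_
    exact measureReal_le_one

theorem sum_abs_le_two {Λ I : Type*} [Fintype Λ] [AddMonoidWithOne I] [MeasurableSpace Λ]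
    [MeasurableSingletonClass Λ] {X : Set (I → Λ)} (l : ℕ) (p q : BlockOrMeasure X) :
    ∑ C : Fin (l + 1) → Λ, |p.value C - q.value C| ≤ 2 := by
  have h : ∑ C : Fin (l + 1) → Λ, |p.value C - q.value C|
      ≤ ∑ C : Fin (l + 1) → Λ, (p.value C + q.value C) := by
    refine Finset.sum_le_sum fun C _ => ?_
    have h1 := value_nonneg p C
    have h2 := value_nonneg q C
    rw [abs_le]; constructor <;> linarith
  rw [Finset.sum_add_distrib] at h
  linarith [sum_value_le_one l p, sum_value_le_one l q]

theorem summable_dStar {Λ I : Type*} [Fintype Λ] [AddMonoidWithOne I] [MeasurableSpace Λ]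
    [MeasurableSingletonClass Λ] {X : Set (I → Λ)} (p q : BlockOrMeasure X) :
    Summable fun l : ℕ =>
      (1 / 2 : ℝ) ^ (l + 1) * ∑ C : Fin (l + 1) → Λ, |p.value C - q.value C| := by
  refine Summable.of_nonneg_of_le (fun l => ?_) (fun l => ?_) summable_geometric_two
  · exact mul_nonneg (by positivity) (Finset.sum_nonneg fun C _ => abs_nonneg _)
  · have h := mul_le_mul_of_nonneg_left (sum_abs_le_two l p q)
      (show (0 : ℝ) ≤ (1 / 2) ^ (l + 1) by positivity)
    refine h.trans (le_of_eq ?_)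
    rw [pow_succ]; ring

/-- The topology on the space of blocks and measures is that of `d*`. (In the two-sided case
`d*` does not separate measures that agree on all cylinders with nonnegative coordinates,
hence a pseudometric.) -/
instance instPseudoMetricSpaceBlockOrMeasure {Λ I : Type*} [Fintype Λ] [AddMonoidWithOne I] [MeasurableSpace Λ]
    [MeasurableSingletonClass Λ] (X : Set (I → Λ)) : PseudoMetricSpace (BlockOrMeasure X) where
  dist := dStar
  dist_self p := by simp [dStar]
  dist_comm p q := by simp only [dStar, abs_sub_comm]
  dist_triangle p q r := by
    simp only [dStar]
    rw [← (summable_dStar p q).tsum_add (summable_dStar q r)]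
    refine (summable_dStar p r).tsum_le_tsum (fun l => ?_)
      ((summable_dStar p q).add (summable_dStar q r))
    rw [← mul_add, ← Finset.sum_add_distrib]
    exact mul_le_mul_of_nonneg_left
      (Finset.sum_le_sum fun C _ => abs_sub_le _ _ _) (by positivity)

/-- The set of ergodic shift-invariant Borel probability measures on `X`. -/
def ergodicMeasures {Λ I : Type*} [AddMonoidWithOne I] [MeasurableSpace Λ]
    (X : Set (I → Λ)) (hX : MapsTo shift X X) : Set (ProbabilityMeasure X) :=
  {μ | Ergodic (hX.restrict shift X X) (μ : Measure X)}

/-- `[s, t)` is the domain of the occurrence in `x` of a block of length at least `m` that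
occurs in `X` and belongs to `U`. -/
def IsErgodicOn {Λ I : Type*} [AddMonoidWithOne I] [MeasurableSpace Λ] {X : Set (I → Λ)}
    (U : Set (BlockOrMeasure X)) (m : ℕ) (x : I → Λ) (s t : I) : Prop :=
  ∃ B : Block X, BlockOrMeasure.block B ∈ U ∧ m ≤ B.1.1 ∧ t = s + ((B.1.1 : ℕ) : I) ∧
    window x s B.1.1 = B.1.2

/-- The cut points `0 = a 0 ≤ b 0 < a 1 ≤ b 1 < ⋯` represent `x` as `A₁ B₁ A₂ B₂ ⋯`, where the
filler block `A_{j+1}` has domain `[a j, b j)` and the block `B_{j+1}` has domain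
`[b j, a (j+1))`; all the blocks `B_j` belong to `U` and have length at least `m`.
As they are nonempty, these domains cover all coordinates `≥ 0`. -/
structure IsRightDecomposition {Λ I : Type*} [AddMonoidWithOne I] [Preorder I]
    [MeasurableSpace Λ] {X : Set (I → Λ)} (U : Set (BlockOrMeasure X)) (m : ℕ) (x : I → Λ)
    (a b : ℕ → I) : Prop where
  zero : a 0 = 0
  filler : ∀ j, a j ≤ b j
  ergodic : ∀ j, IsErgodicOn U m x (b j) (a (j + 1))

/-- The cut points `⋯ < b 1 ≤ a 1 < b 0 ≤ a 0 = 0` represent the part of `x` on the negative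
coordinates as `⋯ B₋₂ A₋₂ B₋₁ A₋₁`, where the filler block `A_{-(j+1)}` has domain
`[b j, a j)` and the block `B_{-(j+1)}` has domain `[a (j+1), b j)`. -/
structure IsLeftDecomposition {Λ : Type*} [MeasurableSpace Λ] {X : Set (ℤ → Λ)}
    (U : Set (BlockOrMeasure X)) (m : ℕ) (x : ℤ → Λ) (a b : ℕ → ℤ) : Prop where
  zero : a 0 = 0
  filler : ∀ j, b j ≤ a j
  ergodic : ∀ j, IsErgodicOn U m x (a (j + 1)) (b j)

/-- Upper Banach density. -/
def upperBanachDensity {I : Type*} [AddMonoidWithOne I] [Preorder I] (A : Set I) : ℝ :=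
  ⨅ N : ℕ+, ⨆ i : I, ((A ∩ Ico i (i + ((N : ℕ) : I))).ncard : ℝ) / (N : ℕ)

/-- Lower Banach density. -/
def lowerBanachDensity {I : Type*} [AddMonoidWithOne I] [Preorder I] (A : Set I) : ℝ :=
  ⨆ N : ℕ+, ⨅ i : I, ((A ∩ Ico i (i + ((N : ℕ) : I))).ncard : ℝ) / (N : ℕ)

/-- `A` has Banach density `d`. -/
def HasBanachDensity {I : Type*} [AddMonoidWithOne I] [Preorder I] (A : Set I) (d : ℝ) : Prop :=
  upperBanachDensity A = d ∧ lowerBanachDensity A = d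

end Subshift

end

/-! Let `D` be the set of points of `X` at which no `U`-block of length at least `m` starts. Each
length contributes a clopen condition, so `D` is closed. For an ergodic measure `ν`, the mean
ergodic theorem makes word frequencies in the initial block of length `n` converge in measure to the
values of `ν`; as `U` is an open neighbourhood of `ν`, the initial block fails to be in `U` with
probability tending to zero (`tendsto_measure_blockAt_notMem`). Since arbitrarily long blocks are
allowed, `D` lies in this exceptional set for every large `n`, hence `ν D = 0`.

A closed set null for all ergodic measures is null for all invariant ones: otherwise its mass has a
positive maximum over the compact set of invariant measures, and an extreme maximizer is ergodic.
Limits of empirical measures are invariant, so every orbit visits `D` with frequency tending to zero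
uniformly (`eventually_card_visits_le`).

Thus the positions of `x` where no suitable block starts have Banach density zero. Scanning
greedily, and taking a block wherever one starts, leaves only such positions as filler. On the
negative side blocks must end, rather than start, at the scanned position; invariance of `ν`
transfers the estimate. The offset `s` treats both cases: `s k = 0` for blocks starting at `i`, `s k
= -k` for blocks ending at `i`. -/

open Filter Topology Function
open scoped ENNReal BoundedContinuousFunction

/-! ### Mean ergodic theorem in measure -/

/-- Mean ergodic theorem for an ergodic probability measure: the Birkhoff averages of a square
integrable function converge in measure to its integral. -/
theorem Ergodic.tendstoInMeasure_birkhoffAverage {α : Type*} [MeasurableSpace α] {μ : Measure α}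
    [IsProbabilityMeasure μ] {T : α → α} (hT : Ergodic T μ) {f : α → ℝ} (hf : MemLp f 2 μ) :
    TendstoInMeasure μ (fun n => birkhoffAverage ℝ T f n) atTop fun _ => ∫ x, f x ∂μ := by
  have hTμ : MeasurePreserving T μ μ := hT.toMeasurePreserving
  let K : Lp ℝ 2 μ →L[ℝ] Lp ℝ 2 μ :=
    (Lp.compMeasurePreservingₗᵢ ℝ T hTμ).toContinuousLinearMap
  have hK (g : Lp ℝ 2 μ) : (K g : α → ℝ) =ᵐ[μ] g ∘ T := Lp.coeFn_compMeasurePreserving g hTμ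
  have hiter (n : ℕ) : (K^[n] (hf.toLp f) : α → ℝ) =ᵐ[μ] fun x => f (T^[n] x) := by
    induction n with
    | zero => exact hf.coeFn_toLp
    | succ n ih =>
      rw [iterate_succ_apply']
      refine (hK _).trans ((hTμ.quasiMeasurePreserving.ae_eq_comp ih).trans ?_)
      exact Eventually.of_forall fun x => by simp [iterate_succ_apply]
  have havg (n : ℕ) : ((birkhoffAverage ℝ K _root_.id n (hf.toLp f) : Lp ℝ 2 μ) : α → ℝ) =ᵐ[μ]
      birkhoffAverage ℝ T f n := by
    have hsum : ((birkhoffSum K _root_.id n (hf.toLp f) : Lp ℝ 2 μ) : α → ℝ) =ᵐ[μ] birkhoffSum T f n := by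
      induction n with
      | zero => simpa [birkhoffSum] using Lp.coeFn_zero ℝ 2 μ
      | succ n ih =>
        rw [birkhoffSum_succ]
        filter_upwards [Lp.coeFn_add (birkhoffSum K _root_.id n (hf.toLp f))
          (_root_.id (K^[n] (hf.toLp f))), ih, hiter n] with x h1 h2 h3
        rw [h1, Pi.add_apply, h2, birkhoffSum_succ]
        simpa using h3
    unfold birkhoffAverage
    filter_upwards [Lp.coeFn_smul (n : ℝ)⁻¹ (birkhoffSum K _root_.id n (hf.toLp f)), hsum]
      with x h1 h2
    rw [h1, Pi.smul_apply, h2]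
  -- The Koopman operator `K` is an isometry, so von Neumann's theorem gives convergence to the
  -- projection onto its fixed vectors; ergodicity makes that projection a constant.
  have hlim := K.tendsto_birkhoffAverage_orthogonalProjection
    (LinearIsometry.norm_toContinuousLinearMap_le _) (hf.toLp f)
  set S := K.eqLocus (1 : Lp ℝ 2 μ →L[ℝ] Lp ℝ 2 μ) with hS
  set P : Lp ℝ 2 μ := ((S.orthogonalProjectionOnto (hf.toLp f) : S) : Lp ℝ 2 μ) with hP
  have hPS : K P = P := (S.orthogonalProjectionOnto (hf.toLp f)).2
  obtain ⟨c, hc⟩ := hT.ae_eq_const_of_ae_eq_comp_ae (Lp.aestronglyMeasurable P)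
    ((hK P).symm.trans (by rw [hPS]))
  -- The constant function 1 is fixed by `K`; pairing with it shows that the projection keeps the
  -- integral, which identifies the constant.
  let e : Lp ℝ 2 μ := indicatorConstLp 2 MeasurableSet.univ (measure_ne_top μ univ) (1 : ℝ)
  have hone : e ∈ S := by
    change K e = e
    apply Lp.ext
    refine (hK _).trans ?_
    have h : (e : α → ℝ) =ᵐ[μ] univ.indicator fun _ => 1 := indicatorConstLp_coeFn (p := 2) (hs := MeasurableSet.univ)
      (hμs := measure_ne_top μ univ) (c := (1 : ℝ))
    filter_upwards [h, hTμ.quasiMeasurePreserving.ae_eq_comp h] with x h1 h2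
    rw [h1, h2]; simp
  have hint : ∫ x, P x ∂μ = ∫ x, f x ∂μ := by
    have h := S.inner_orthogonalProjectionOnto_eq_of_mem_left ⟨_, hone⟩ (hf.toLp f)
    have h' : inner ℝ e P = inner ℝ e (hf.toLp f) := h
    rw [L2.inner_indicatorConstLp_one, L2.inner_indicatorConstLp_one] at h'
    simp only [Measure.restrict_univ] at h'
    rw [h', integral_congr_ae hf.coeFn_toLp]
  have hcf : c = ∫ x, f x ∂μ := by
    rw [← hint, integral_congr_ae hc]; simp
  refine (tendstoInMeasure_of_tendsto_Lp hlim).congr havg ?_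
  rw [← hcf]
  exact hc

/-! ### Closed sets, ergodic measures and uniform visit frequencies -/

namespace MeasureTheory

/-- This is the portmanteau inequality; it lets the mass of a closed set attain its maximum on a
compact set of measures. -/
theorem ProbabilityMeasure.upperSemicontinuous_apply_of_isClosed {α : Type*} [TopologicalSpace α] [MeasurableSpace α]
    [OpensMeasurableSpace α] [HasOuterApproxClosed α] {D : Set α} (hD : IsClosed D) :
    UpperSemicontinuous fun μ : ProbabilityMeasure α => (μ : Measure α) D := by
  rw [upperSemicontinuous_iff_limsup_le]
  exact fun μ => ProbabilityMeasure.limsup_measure_closed_le_of_tendsto tendsto_id hD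

/-- A closed set charged by some invariant probability measure is charged by an ergodic one. -/
theorem exists_ergodic_measure_ne_zero {α : Type*} [TopologicalSpace α] [CompactSpace α] [T2Space α]
    [MeasurableSpace α] [BorelSpace α] [HasOuterApproxClosed α] {T : α → α} (hT : Continuous T) {D : Set α}
    (hD : IsClosed D) (μ : ProbabilityMeasure α) (hμ : MeasurePreserving T (μ : Measure α) μ)
    (hμD : (μ : Measure α) D ≠ 0) :
    ∃ ν : ProbabilityMeasure α, Ergodic T (ν : Measure α) ∧ (ν : Measure α) D ≠ 0 := by
  let Inv : Set (ProbabilityMeasure α) := {ν | MeasurePreserving T (ν : Measure α) ν}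
  have hInv : IsCompact Inv := by
    apply IsClosed.isCompact
    have : Inv = {ν | ν.map hT.aemeasurable = ν} := by
      ext ν
      rw [mem_ofPred_eq, mem_ofPred_eq, ← ProbabilityMeasure.toMeasure_injective.eq_iff]
      exact ⟨fun h => h.map_eq, fun h => ⟨hT.measurable, h⟩⟩
    rw [this]
    exact isClosed_eq (ProbabilityMeasure.continuous_map hT) continuous_id
  have husc := ProbabilityMeasure.upperSemicontinuous_apply_of_isClosed hD
  obtain ⟨μ₀, hμ₀, hmax⟩ := UpperSemicontinuousOn.exists_isMaxOn ⟨μ, hμ⟩ hInv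
    (husc.upperSemicontinuousOn Inv)
  rw [isMaxOn_iff] at hmax
  set M := (μ₀ : Measure α) D with hM
  have hMpos : M ≠ 0 := (lt_of_lt_of_le (pos_iff_ne_zero.2 hμD) (hmax μ hμ)).ne'
  let Mx : Set (ProbabilityMeasure α) := Inv ∩ {ν | M ≤ (ν : Measure α) D}
  have hMx : IsCompact Mx := hInv.inter_right (husc.isClosed_preimage M)
  -- Probability measures are not a vector space, so extreme points are found in the image under
  -- integration against bounded continuous functions, inside a product of lines.
  let Φ : ProbabilityMeasure α → (α →ᵇ ℝ) → ℝ := fun ν f => ∫ x, f x ∂(ν : Measure α)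
  have hΦ : Continuous Φ := continuous_pi fun f =>
    continuous_iff_continuousAt.2 fun ν =>
      (ProbabilityMeasure.tendsto_iff_forall_integral_tendsto.1 tendsto_id) f
  have hinj : Injective Φ := fun ν₁ ν₂ h =>
    ProbabilityMeasure.toMeasure_injective
      (ext_of_forall_integral_eq_of_IsFiniteMeasure fun f => congrFun h f)
  obtain ⟨p, ⟨ν, hν, rfl⟩, hext⟩ :=
    (hMx.image hΦ).extremePoints_nonempty ⟨_, mem_image_of_mem Φ ⟨hμ₀, mem_ofPred_eq ▸ le_rfl⟩⟩
  refine ⟨ν, ?_, (lt_of_lt_of_le (pos_iff_ne_zero.2 hMpos) hν.2).ne'⟩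
  refine Ergodic.of_mem_extremePoints ⟨⟨hν.1, inferInstance⟩, ?_⟩
  rintro ν₁ ⟨hi₁, hp₁⟩ ν₂ ⟨hi₂, hp₂⟩ ⟨a, b, ha, hb, hab, hcomb⟩
  have ha' : a ≠ ∞ := ne_top_of_le_ne_top ENNReal.one_ne_top (hab ▸ le_self_add)
  have hb' : b ≠ ∞ := ne_top_of_le_ne_top ENNReal.one_ne_top (hab ▸ le_add_self)
  have hle₁ : ν₁ D ≤ M := hmax ⟨ν₁, hp₁⟩ hi₁
  have hle₂ : ν₂ D ≤ M := hmax ⟨ν₂, hp₂⟩ hi₂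
  have hMtop : M ≠ ∞ := measure_ne_top _ _
  -- The maximizers form a face: a component giving `D` mass below `M` would pull the combination
  -- below `M`. Extremality among maximizers is therefore extremality among invariant measures, that
  -- is, ergodicity.
  have hD₁₂ : M ≤ a * ν₁ D + b * ν₂ D := by
    have h := hν.2
    simpa [← hcomb] using h
  have hMab : M = a * M + b * M := by rw [← add_mul, hab, one_mul]
  have hm₁ : M ≤ ν₁ D := by
    by_contra! hlt
    refine absurd hD₁₂ (not_le.2 ?_)
    conv_rhs => rw [hMab]
    exact ENNReal.add_lt_add_of_lt_of_le (ENNReal.mul_ne_top hb' (measure_ne_top _ _))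
      ((ENNReal.mul_lt_mul_iff_right ha.ne' ha').2 hlt) (by gcongr)
  have hm₂ : M ≤ ν₂ D := by
    by_contra! hlt
    refine absurd hD₁₂ (not_le.2 ?_)
    conv_rhs => rw [hMab]
    exact ENNReal.add_lt_add_of_le_of_lt (ENNReal.mul_ne_top ha' (measure_ne_top _ _))
      (by gcongr) ((ENNReal.mul_lt_mul_iff_right hb.ne' hb').2 hlt)
  have hΦeq : Φ ⟨ν₁, hp₁⟩ = Φ ν := by
    have h₁ : (⟨ν₁, hp₁⟩ : ProbabilityMeasure α) ∈ Mx := ⟨hi₁, hm₁⟩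
    have h₂ : (⟨ν₂, hp₂⟩ : ProbabilityMeasure α) ∈ Mx := ⟨hi₂, hm₂⟩
    refine hext (mem_image_of_mem Φ h₁) (mem_image_of_mem Φ h₂) ⟨a.toReal, b.toReal, ENNReal.toReal_pos ha.ne' ha',
        ENNReal.toReal_pos hb.ne' hb', ?_, ?_⟩
    · rw [← ENNReal.toReal_add ha' hb', hab, ENNReal.toReal_one]
    · funext f
      have h₁ := f.integrable ν₁
      have h₂ := f.integrable ν₂
      simp only [Φ, Pi.add_apply, Pi.smul_apply, smul_eq_mul, ProbabilityMeasure.coe_mk]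
      rw [← hcomb, integral_add_measure (h₁.smul_measure ha') (h₂.smul_measure hb'),
        integral_smul_measure, integral_smul_measure]
      rfl
  exact congrArg ProbabilityMeasure.toMeasure (hinj hΦeq)

/-- The empirical measure of the first `n` points of the orbit of `y`. -/
noncomputable def empiricalMeasure {α : Type*} [MeasurableSpace α] (T : α → α) (y : α) (n : ℕ) : Measure α :=
  (n : ℝ≥0∞)⁻¹ • ∑ j ∈ Finset.range n, Measure.dirac (T^[j] y)

theorem isProbabilityMeasure_empiricalMeasure {α : Type*} [MeasurableSpace α] (T : α → α) (y : α) {n : ℕ} (hn : n ≠ 0) :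
    IsProbabilityMeasure (empiricalMeasure T y n) := by
  constructor
  simp [empiricalMeasure, ENNReal.inv_mul_cancel, hn]

theorem integral_empiricalMeasure {α : Type*} [TopologicalSpace α] [MeasurableSpace α]
    [OpensMeasurableSpace α] (T : α → α) (y : α) (n : ℕ) (f : α →ᵇ ℝ) :
    ∫ x, f x ∂(empiricalMeasure T y n) = birkhoffAverage ℝ T f n y := by
  rw [empiricalMeasure, integral_smul_measure,
    integral_finsetSum_measure fun i _ => f.integrable _]
  simp [birkhoffAverage, birkhoffSum,
    integral_dirac' _ _ f.continuous.stronglyMeasurable]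

open Classical in
theorem empiricalMeasure_apply {α : Type*} [MeasurableSpace α] (T : α → α) (y : α) (n : ℕ) {D : Set α} (hD : MeasurableSet D) :
    empiricalMeasure T y n D =
      (n : ℝ≥0∞)⁻¹ * ((Finset.range n).filter fun j => T^[j] y ∈ D).card := by
  simp [empiricalMeasure, Measure.dirac_apply' _ hD, indicator_apply]

open Classical in
/-- If no ergodic measure charges the closed set `D`, then the orbits visit `D` with frequency
tending to zero uniformly. -/
theorem eventually_card_visits_le {α : Type*} [TopologicalSpace α] [CompactSpace α] [T2Space α]
    [MeasurableSpace α] [BorelSpace α] [HasOuterApproxClosed α] {T : α → α} (hT : Continuous T) {D : Set α} (hD : IsClosed D)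
    (h : ∀ ν : ProbabilityMeasure α, Ergodic T (ν : Measure α) → (ν : Measure α) D = 0)
    {ε : ℝ} (hε : 0 < ε) :
    ∀ᶠ n : ℕ in atTop, ∀ y : α,
      (((Finset.range n).filter fun j => T^[j] y ∈ D).card : ℝ) ≤ ε * n := by
  by_contra hcon
  rw [eventually_atTop] at hcon
  push Not at hcon
  -- The threshold `k + 1` makes `N k` positive and tend to infinity.
  choose N hN y hy using fun k : ℕ => hcon (k + 1)
  have hN0 (k : ℕ) : N k ≠ 0 := by have := hN k; omega
  let μs : ℕ → ProbabilityMeasure α := fun k =>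
    ⟨empiricalMeasure T (y k) (N k), isProbabilityMeasure_empiricalMeasure T _ (hN0 k)⟩
  -- The space is not assumed metrizable, so a limit along an ultrafilter replaces a convergent
  -- subsequence.
  let L : Filter ℕ := (Ultrafilter.of atTop : Ultrafilter ℕ)
  have hL : L ≤ atTop := Ultrafilter.of_le _
  obtain ⟨μ, -, hμ⟩ := isCompact_univ.ultrafilter_le_nhds
    ((Ultrafilter.of atTop).map μs) (by simp)
  have hlim : Tendsto μs L (𝓝 μ) := hμ
  have hNtop : Tendsto N L atTop :=
    (tendsto_atTop_mono (fun k => (Nat.le_succ k).trans (hN k)) tendsto_id).mono_left hL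
  have hinv : MeasurePreserving T (μ : Measure α) μ := by
    refine ⟨hT.measurable, ?_⟩
    have := Measure.isProbabilityMeasure_map (μ := (μ : Measure α)) hT.aemeasurable
    refine ext_of_forall_integral_eq_of_IsFiniteMeasure fun f => ?_
    rw [integral_map hT.aemeasurable f.continuous.aestronglyMeasurable]
    let fT : α →ᵇ ℝ := f.compContinuous ⟨T, hT⟩
    have h1 := ProbabilityMeasure.tendsto_iff_forall_integral_tendsto.1 hlim f
    have h2 := ProbabilityMeasure.tendsto_iff_forall_integral_tendsto.1 hlim fT
    have h3 : Tendsto (fun k => ∫ x, fT x ∂(μs k : Measure α) - ∫ x, f x ∂(μs k : Measure α)) L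
        (𝓝 0) := by
      -- The averages at `T y` and at `y` telescope to two boundary terms divided by `N k`.
      have hb : Tendsto (fun k => 2 * ‖f‖ / (N k : ℝ)) L (𝓝 0) :=
        tendsto_const_nhds.div_atTop (tendsto_natCast_atTop_atTop.comp hNtop)
      refine squeeze_zero_norm (fun k => ?_) hb
      have e1 : ∫ x, fT x ∂(μs k : Measure α) = birkhoffAverage ℝ T f (N k) (T (y k)) := by
        refine (integral_empiricalMeasure T (y k) (N k) fT).trans ?_
        simp only [birkhoffAverage, birkhoffSum, fT]
        congr 1
        refine Finset.sum_congr rfl fun j _ => ?_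
        simp [← iterate_succ_apply, iterate_succ_apply']
      have e2 : ∫ x, f x ∂(μs k : Measure α) = birkhoffAverage ℝ T f (N k) (y k) :=
        integral_empiricalMeasure T (y k) (N k) f
      rw [e1, e2, ← dist_eq_norm, dist_birkhoffAverage_apply_birkhoffAverage]
      gcongr
      exact f.dist_le_two_norm _ _
    exact sub_eq_zero.1 (tendsto_nhds_unique (h2.sub h1) h3)
  have hεD : ENNReal.ofReal ε ≤ (μ : Measure α) D := by
    refine le_trans ?_ (ProbabilityMeasure.limsup_measure_closed_le_of_tendsto hlim hD)
    refine le_limsup_of_frequently_le (Frequently.of_forall fun k => ?_)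
    change _ ≤ empiricalMeasure T (y k) (N k) D
    rw [empiricalMeasure_apply _ _ _ hD.measurableSet, ← ENNReal.div_eq_inv_mul,
      ENNReal.le_div_iff_mul_le (by simp [hN0 k]) (by simp), ← ENNReal.ofReal_natCast (N k),
      ← ENNReal.ofReal_mul hε.le, ← ENNReal.ofReal_natCast]
    exact ENNReal.ofReal_le_ofReal (hy k).le
  obtain ⟨ν, hν, hνD⟩ := exists_ergodic_measure_ne_zero hT hD μ hinv
    (lt_of_lt_of_le (ENNReal.ofReal_pos.2 hε) hεD).ne'
  exact hνD (h ν hν)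

end MeasureTheory

/-! ### Blocks, their frequencies and the exceptional positions -/

namespace Subshift

theorem iterate_shift_apply {Λ I : Type*} [AddCommMonoidWithOne I] (n : ℕ) (x : I → Λ) (i : I) :
    shift^[n] x i = x (n + i) := by
  induction n generalizing x with
  | zero => simp
  | succ n ih =>
    rw [iterate_succ_apply, ih, shift, Nat.cast_succ]
    congr 1
    rw [add_right_comm]

theorem coe_iterate_restrict_shift_apply {Λ I : Type*} [AddCommMonoidWithOne I]
    {X : Set (I → Λ)} (hX : MapsTo shift X X) (n : ℕ) (y : X) (i : I) :
    ((hX.restrict shift X X)^[n] y : I → Λ) i = (y : I → Λ) (n + i) := by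
  rw [hX.iterate_restrict n, MapsTo.val_restrict_apply, iterate_shift_apply]

/-- The block of length `k + 1` of `y ∈ X` at the position `i`. -/
def blockAt {Λ I : Type*} [AddMonoidWithOne I] {X : Set (I → Λ)} (y : X) (i : I) (k : ℕ) :
    Block X :=
  ⟨⟨k + 1, window (y : I → Λ) i (k + 1)⟩, k.succ_pos, y, y.2, i, rfl⟩

/-- A block does not remember which point and position exhibit it, so membership in `U` depends on
the window alone. -/
theorem blockAt_congr {Λ I : Type*} [AddMonoidWithOne I] {X : Set (I → Λ)} {y z : X} {i j : I}
    {k : ℕ} (h : window (y : I → Λ) i (k + 1) = window (z : I → Λ) j (k + 1)) :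
    blockAt y i k = blockAt z j k := by
  apply Subtype.ext
  simp only [blockAt, h]

theorem blockAt_of_translate {Λ I : Type*} [AddMonoidWithOne I] {X : Set (I → Λ)} {y z : X}
    {i : I} (h : ∀ j, (y : I → Λ) j = (z : I → Λ) (i + j)) (j : I) (k : ℕ) :
    blockAt y j k = blockAt z (i + j) k := by
  apply blockAt_congr
  funext t
  simp only [window, h, add_assoc]

/-- The positions `i` such that no `U`-block of length at least `m` occurs in `x` at any of the
positions `i + s k`, where `k + 1` is the length of the block. -/
def nonErgodicPositions {Λ I : Type*} [AddMonoidWithOne I] [MeasurableSpace Λ] {X : Set (I → Λ)}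
    (U : Set (BlockOrMeasure X)) (m : ℕ) (s : ℕ → I) (y : X) : Set I :=
  {i | ∀ k, m ≤ k + 1 → BlockOrMeasure.block (blockAt y (i + s k) k) ∉ U}

theorem mem_nonErgodicPositions {Λ I : Type*} [AddMonoidWithOne I] [MeasurableSpace Λ]
    {X : Set (I → Λ)} {U : Set (BlockOrMeasure X)} {m : ℕ} {s : ℕ → I} {y : X} {i : I} :
    i ∈ nonErgodicPositions U m s y ↔
      ∀ k, m ≤ k + 1 → BlockOrMeasure.block (blockAt y (i + s k) k) ∉ U :=
  Iff.rfl

theorem mem_nonErgodicPositions_of_translate {Λ I : Type*} [AddMonoidWithOne I]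
    [MeasurableSpace Λ] {X : Set (I → Λ)} {U : Set (BlockOrMeasure X)} {m : ℕ} {s : ℕ → I}
    {y z : X} {i : I} (h : ∀ j, (y : I → Λ) j = (z : I → Λ) (i + j)) (j : I) :
    j ∈ nonErgodicPositions U m s y ↔ i + j ∈ nonErgodicPositions U m s z := by
  simp only [mem_nonErgodicPositions, blockAt_of_translate h, add_assoc]

/-- The condition depends on finitely many coordinates, each with values in a discrete space. -/
theorem isClopen_blockAt_mem {Λ I : Type*} [TopologicalSpace Λ] [DiscreteTopology Λ] [Finite Λ]
    [AddMonoidWithOne I] {X : Set (I → Λ)} (s : I) (k : ℕ) (V : Set (Block X)) :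
    IsClopen {y : X | blockAt y s k ∈ V} := by
  have hcont : Continuous fun y : X => window (y : I → Λ) s (k + 1) :=
    continuous_pi fun t => (continuous_apply _).comp continuous_subtype_val
  have heq : {y : X | blockAt y s k ∈ V} = (fun y : X => window (y : I → Λ) s (k + 1)) ⁻¹'
      {w | ∃ z : X, window (z : I → Λ) s (k + 1) = w ∧ blockAt z s k ∈ V} := by
    ext y
    constructor
    · exact fun h => ⟨y, rfl, h⟩
    · rintro ⟨z, hz, h⟩
      change blockAt y s k ∈ V
      rwa [← blockAt_congr hz]
  rw [heq]
  exact (isClopen_discrete _).preimage hcont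

/-- Closeness with respect to `d*` follows from closeness on finitely many words. -/
theorem exists_forall_abs_sub_lt_imp_dist_lt {Λ I : Type*} [Fintype Λ] [AddMonoidWithOne I]
    [MeasurableSpace Λ] [MeasurableSingletonClass Λ] (X : Set (I → Λ)) {ε : ℝ} (hε : 0 < ε) :
    ∃ (L : ℕ) (δ : ℝ), 0 < δ ∧ ∀ p q : BlockOrMeasure X,
      (∀ l < L, ∀ C : Fin (l + 1) → Λ, |p.value C - q.value C| < δ) → dist p q < ε := by
  obtain ⟨L, hL⟩ := exists_pow_lt_of_lt_one (show (0 : ℝ) < ε / 4 by positivity)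
    (show (1 / 2 : ℝ) < 1 by norm_num)
  let N : ℝ := ∑ l ∈ Finset.range L, Fintype.card (Fin (l + 1) → Λ)
  have hN : 0 ≤ N := Finset.sum_nonneg fun _ _ => Nat.cast_nonneg _
  -- Each half of `ε` has its own source: the tail beyond `L` is at most `2 * (1/2)^L`, and `N`
  -- counts the remaining words. The `+ 1` guards against `N = 0`.
  refine ⟨L, ε / (2 * (N + 1)), by positivity, fun p q h => ?_⟩
  change dStar p q < ε
  rw [dStar, ← (summable_dStar p q).sum_add_tsum_nat_add L]
  have h1 : ∑ l ∈ Finset.range L, (1 / 2 : ℝ) ^ (l + 1) *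
      ∑ C : Fin (l + 1) → Λ, |p.value C - q.value C| ≤ N * (ε / (2 * (N + 1))) := by
    rw [Finset.sum_mul]
    refine Finset.sum_le_sum fun l hl => ?_
    refine (mul_le_of_le_one_left (Finset.sum_nonneg fun C _ => abs_nonneg _)
      (pow_le_one₀ (by norm_num) (by norm_num))).trans ?_
    refine (Finset.sum_le_sum fun C _ => (h l (Finset.mem_range.1 hl) C).le).trans ?_
    simp
  have h2 : ∑' l : ℕ, (1 / 2 : ℝ) ^ (l + L + 1) *
      ∑ C : Fin (l + L + 1) → Λ, |p.value C - q.value C| ≤ (1 / 2) ^ L * 2 := by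
    have hs := (summable_nat_add_iff L).2 (summable_dStar p q)
    have hg : HasSum (fun l : ℕ => (1 / 2 : ℝ) ^ L * (1 / 2) ^ l) ((1 / 2) ^ L * 2) :=
      hasSum_geometric_two.mul_left _
    rw [← hg.tsum_eq]
    refine hs.tsum_le_tsum (fun l => ?_) hg.summable
    refine (mul_le_mul_of_nonneg_left (sum_abs_le_two (l + L) p q) (by positivity)).trans ?_
    rw [pow_succ, pow_add]
    exact le_of_eq (by ring)
  have h3 : N * (ε / (2 * (N + 1))) ≤ ε / 2 := by
    rw [mul_div_assoc', div_le_div_iff₀ (by positivity) two_pos]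
    nlinarith
  linarith

open Classical in
theorem freq_window_eq {Λ I : Type*} [AddMonoidWithOne I] (x : I → Λ) (i : I) (k l : ℕ)
    (C : Fin l → Λ) :
    freq (window x i k) C =
      ((Finset.range (k + 1 - l)).filter fun j : ℕ => window x (i + (j : I)) l = C).card / k := by
  unfold freq
  congr 2
  have hsub (t : Fin (k + 1 - l)) :
      subblock (window x i k) t = window x (i + ((t : ℕ) : I)) l := by
    funext r
    simp [subblock, window, add_assoc]
  refine Finset.card_bij (fun t _ => (t : ℕ)) (fun t ht => ?_) (fun _ _ _ _ h => Fin.ext h)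
    fun j hj => ?_
  · simpa [← hsub] using ht
  · rw [Finset.mem_filter, Finset.mem_range] at hj
    exact ⟨⟨j, hj.1⟩, by simpa [hsub] using hj.2, rfl⟩

-- Only the last `l` starting positions can overhang the window. This compares block frequencies,
-- which count occurrences inside the block, with Birkhoff averages, which count all starting
-- positions.
open Classical in
theorem abs_freq_window_sub_le {Λ I : Type*} [AddMonoidWithOne I] (x : I → Λ) (i : I) (k l : ℕ)
    (C : Fin (l + 1) → Λ) :
    |freq (window x i k) C -
      ((Finset.range k).filter fun j : ℕ => window x (i + (j : I)) (l + 1) = C).card / (k : ℝ)|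
      ≤ l / k := by
  rw [freq_window_eq, ← sub_div, abs_div, Nat.abs_cast]
  gcongr
  have hsub : (Finset.range (k + 1 - (l + 1))).filter (fun j : ℕ => window x (i + (j : I)) (l + 1) = C)
      ⊆ (Finset.range k).filter fun j : ℕ => window x (i + (j : I)) (l + 1) = C :=
    Finset.filter_subset_filter _ (Finset.range_subset_range.2 (by omega))
  have h1 := Finset.card_le_card hsub
  have h2 : ((Finset.range k).filter fun j : ℕ => window x (i + (j : I)) (l + 1) = C).card ≤
      ((Finset.range (k + 1 - (l + 1))).filter
        fun j : ℕ => window x (i + (j : I)) (l + 1) = C).card + l := by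
    refine (Finset.card_le_card (t := (Finset.range (k + 1 - (l + 1))).filter
        (fun j : ℕ => window x (i + (j : I)) (l + 1) = C) ∪ Finset.Ico (k - l) k) fun j hj => ?_).trans
      ((Finset.card_union_le _ _).trans ?_)
    · simp only [Finset.mem_union, Finset.mem_filter, Finset.mem_range, Finset.mem_Ico] at hj ⊢
      by_cases hjl : j < k - l
      · exact Or.inl ⟨by omega, hj.2⟩
      · exact Or.inr ⟨by omega, hj.1⟩
    · rw [Nat.card_Ico]; omega
  rw [abs_sub_comm, abs_of_nonneg (sub_nonneg.2 (by exact_mod_cast h1)), sub_le_iff_le_add']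
  exact_mod_cast h2

/-- With respect to an ergodic measure belonging to the open set `U`, the probability that the
initial block of length `k + 1` does not belong to `U` tends to zero. -/
theorem tendsto_measure_blockAt_notMem {Λ I : Type*} [Fintype Λ] [AddCommMonoidWithOne I]
    [MeasurableSpace Λ] [MeasurableSingletonClass Λ] {X : Set (I → Λ)} (hX : MapsTo shift X X)
    {U : Set (BlockOrMeasure X)} (hU : IsOpen U) {ν : ProbabilityMeasure X}
    (hν : ν ∈ ergodicMeasures X hX) (hνU : BlockOrMeasure.measure ν ∈ U) :
    Tendsto (fun k => (ν : Measure X) {y | BlockOrMeasure.block (blockAt y 0 k) ∉ U}) atTop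
      (𝓝 0) := by
  classical
  obtain ⟨ε, hε, hball⟩ := Metric.isOpen_iff.1 hU _ hνU
  obtain ⟨L, δ, hδ, hLδ⟩ := exists_forall_abs_sub_lt_imp_dist_lt X hε
  set T := hX.restrict shift X X
  have hT : Ergodic T (ν : Measure X) := hν
  have hmeas (l : ℕ) (C : Fin l → Λ) :
      MeasurableSet {x : X | window (x : I → Λ) 0 l = C} :=
    (measurable_pi_lambda _ fun j => (measurable_pi_apply _).comp measurable_subtype_coe :
      Measurable fun x : X => window (x : I → Λ) 0 l) (measurableSet_singleton C)
  let φ (l : ℕ) (C : Fin l → Λ) : X → ℝ := {x : X | window (x : I → Λ) 0 l = C}.indicator 1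
  have hφ (l : ℕ) (C : Fin l → Λ) : TendstoInMeasure (ν : Measure X)
      (fun n => birkhoffAverage ℝ T (φ l C) n) atTop
      fun _ => (BlockOrMeasure.measure ν).value C := by
    have h := hT.tendstoInMeasure_birkhoffAverage
      (memLp_indicator_const 2 (hmeas l C) (1 : ℝ) (Or.inr (measure_ne_top _ _)))
    have hint : ∫ x, ({x : X | window (x : I → Λ) 0 l = C}.indicator fun _ => (1 : ℝ)) x
        ∂(ν : Measure X) = (BlockOrMeasure.measure ν).value C := by
      rw [integral_indicator_const _ (hmeas l C)]
      simp [BlockOrMeasure.value]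
    rw [hint] at h
    exact h
  have havg (l : ℕ) (C : Fin l → Λ) (n : ℕ) (y : X) : birkhoffAverage ℝ T (φ l C) n y =
      ((Finset.range n).filter fun j : ℕ => window (y : I → Λ) (0 + (j : I)) l = C).card /
        (n : ℝ) := by
    have hj (j : ℕ) : window (T^[j] y : I → Λ) 0 l = window (y : I → Λ) (0 + (j : I)) l := by
      funext t
      simp only [window, T, coe_iterate_restrict_shift_apply, zero_add]
    simp only [birkhoffAverage, birkhoffSum, φ, indicator_apply, mem_ofPred_eq, hj]
    rw [smul_eq_mul, inv_mul_eq_div]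
    simp
  -- Half of `δ` is spent on the deviation of the Birkhoff average, the other half on the overhang
  -- `L / (k + 1)`.
  let bad (k l : ℕ) (C : Fin (l + 1) → Λ) : Set X :=
    {y | δ / 2 ≤ dist (birkhoffAverage ℝ T (φ (l + 1) C) (k + 1) y)
      ((BlockOrMeasure.measure ν).value C)}
  have hbad (l : ℕ) (C : Fin (l + 1) → Λ) :
      Tendsto (fun k => (ν : Measure X) (bad k l C)) atTop (𝓝 0) :=
    ((tendstoInMeasure_iff_dist.1 (hφ (l + 1) C)) (δ / 2) (half_pos hδ)).comp
      (tendsto_add_atTop_nat 1)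
  have hsum : Tendsto (fun k => ∑ l ∈ Finset.range L, ∑ C : Fin (l + 1) → Λ,
      (ν : Measure X) (bad k l C)) atTop (𝓝 0) := by
    have h : Tendsto (fun k => ∑ l ∈ Finset.range L, ∑ C : Fin (l + 1) → Λ,
        (ν : Measure X) (bad k l C)) atTop
        (𝓝 (∑ l ∈ Finset.range L, ∑ _C : Fin (l + 1) → Λ, 0)) :=
      tendsto_finsetSum _ fun l _ => tendsto_finsetSum _ fun C _ => hbad l C
    simpa using h
  have hlarge : ∀ᶠ k : ℕ in atTop, (L : ℝ) / ((k + 1 : ℕ) : ℝ) < δ / 2 := by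
    have h : Tendsto (fun n : ℕ => (L : ℝ) / (n : ℝ)) atTop (𝓝 0) :=
      tendsto_const_div_atTop_nhds_zero_nat _
    exact (h.comp (tendsto_add_atTop_nat 1)).eventually_lt_const (half_pos hδ)
  refine tendsto_of_tendsto_of_tendsto_of_le_of_le' tendsto_const_nhds hsum
    (Eventually.of_forall fun _ => zero_le) ?_
  filter_upwards [hlarge] with k hk
  have hsub : {y : X | BlockOrMeasure.block (blockAt y 0 k) ∉ U} ⊆
      ⋃ l ∈ Finset.range L, ⋃ C : Fin (l + 1) → Λ, bad k l C := by
    intro y hy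
    by_contra hcon
    simp only [mem_iUnion, not_exists] at hcon
    refine hy (hball (Metric.mem_ball.2 (hLδ _ _ fun l hl C => ?_)))
    have h1 : dist (birkhoffAverage ℝ T (φ (l + 1) C) (k + 1) y)
        ((BlockOrMeasure.measure ν).value C) < δ / 2 :=
      not_le.1 (hcon l (Finset.mem_range.2 hl) C)
    have h2 := abs_freq_window_sub_le (y : I → Λ) 0 (k + 1) l C
    rw [← havg] at h2
    have h3 : (l : ℝ) / ((k + 1 : ℕ) : ℝ) ≤ L / ((k + 1 : ℕ) : ℝ) := by gcongr
    have h4 := abs_sub_le (freq (window (y : I → Λ) 0 (k + 1)) C)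
      (birkhoffAverage ℝ T (φ (l + 1) C) (k + 1) y) ((BlockOrMeasure.measure ν).value C)
    rw [Real.dist_eq] at h1
    change |freq (window (y : I → Λ) 0 (k + 1)) C - _| < δ
    linarith
  refine (measure_mono hsub).trans ((measure_biUnion_finset_le _ _).trans ?_)
  exact Finset.sum_le_sum fun l _ => measure_iUnion_fintype_le _ _

open Classical in
/-- The positions without long `U`-blocks have density zero, uniformly on `X`. -/
theorem eventually_card_nonErgodicPositions_le {Λ I : Type*} [Fintype Λ] [TopologicalSpace Λ]
    [DiscreteTopology Λ] [MeasurableSpace Λ] [BorelSpace Λ] [AddCommMonoidWithOne I] [Countable I]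
    {X : Set (I → Λ)} (hXc : IsClosed X) (hX : MapsTo shift X X) {U : Set (BlockOrMeasure X)}
    (hU : IsOpen U) (hUerg : ∀ μ ∈ ergodicMeasures X hX, BlockOrMeasure.measure μ ∈ U) (m : ℕ)
    {s : ℕ → I} (hs : ∀ k, ∃ n : ℕ, (n : I) + s k = 0) {ε : ℝ} (hε : 0 < ε) :
    ∀ᶠ n : ℕ in atTop, ∀ y : X,
      (((Finset.range n).filter fun j : ℕ => (j : I) ∈ nonErgodicPositions U m s y).card : ℝ)
        ≤ ε * n := by
  have : CompactSpace X := isCompact_iff_compactSpace.1 hXc.isCompact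
  set T := hX.restrict shift X X with hTdef
  have hTc : Continuous T := by
    refine Continuous.restrict hX ?_
    exact continuous_pi fun i => continuous_apply _
  let D : Set X := {y | 0 ∈ nonErgodicPositions U m s y}
  have hD : IsClosed D := by
    have hDeq : D = ⋂ (k : ℕ) (_ : m ≤ k + 1),
        {y : X | blockAt y (0 + s k) k ∈ {B : Block X | BlockOrMeasure.block B ∉ U}} := by
      ext y
      simp only [mem_iInter]
      exact Iff.rfl
    rw [hDeq]
    exact isClosed_iInter fun k => isClosed_iInter fun _ => (isClopen_blockAt_mem _ _ _).1
  have hnull (ν : ProbabilityMeasure X) (hν : Ergodic T (ν : Measure X)) :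
      (ν : Measure X) D = 0 := by
    refine le_antisymm (ge_of_tendsto (tendsto_measure_blockAt_notMem hX hU hν (hUerg ν hν)) ?_)
      (zero_le)
    filter_upwards [eventually_ge_atTop m] with k hk
    -- Applying `T^[n]` moves the position `s k` to the origin, so the events at `s k` and at `0`
    -- have equal measure.
    obtain ⟨n, hn⟩ := hs k
    have hpre : {y : X | BlockOrMeasure.block (blockAt y 0 k) ∉ U} =
        T^[n] ⁻¹' {y | blockAt y (0 + s k) k ∈ {B : Block X | BlockOrMeasure.block B ∉ U}} := by
      ext y
      change BlockOrMeasure.block (blockAt y 0 k) ∉ U ↔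
        BlockOrMeasure.block (blockAt (T^[n] y) (0 + s k) k) ∉ U
      rw [blockAt_of_translate (coe_iterate_restrict_shift_apply hX n y), zero_add, hn]
    rw [hpre, (hν.toMeasurePreserving.iterate n).measure_preimage
      (isClopen_blockAt_mem _ _ _).1.measurableSet.nullMeasurableSet]
    exact measure_mono fun y hy => hy k (by omega)
  filter_upwards [eventually_card_visits_le hTc hD hnull hε] with n hn y
  refine le_trans (le_of_eq ?_) (hn y)
  congr 2
  refine Finset.filter_congr fun j _ => ?_
  rw [← add_zero (j : I)]
  exact (mem_nonErgodicPositions_of_translate (coe_iterate_restrict_shift_apply hX j y) 0).symm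

/-! ### Banach density zero -/

open Classical in
/-- Uniform smallness of the number of visits in long windows gives Banach density zero. -/
theorem hasBanachDensity_zero {I : Type*} [AddMonoidWithOne I] [Preorder I] {A : Set I}
    (hcount : ∀ (i : I) (n : ℕ), (A ∩ Ico i (i + (n : I))).ncard =
      ((Finset.range n).filter fun j : ℕ => i + (j : I) ∈ A).card)
    (h : ∀ ε : ℝ, 0 < ε → ∀ᶠ n : ℕ in atTop, ∀ i : I,
      (((Finset.range n).filter fun j : ℕ => i + (j : I) ∈ A).card : ℝ) ≤ ε * n) :
    HasBanachDensity A 0 := by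
  have hnonneg (N : ℕ+) (i : I) :
      0 ≤ ((A ∩ Ico i (i + ((N : ℕ) : I))).ncard : ℝ) / (N : ℕ) := by positivity
  refine ⟨le_antisymm (le_of_forall_pos_le_add fun ε hε => ?_)
      (Real.iInf_nonneg fun N => Real.iSup_nonneg (hnonneg N)),
    le_antisymm (Real.iSup_le (fun N => ?_) le_rfl)
      (Real.iSup_nonneg fun N => Real.iInf_nonneg (hnonneg N))⟩
  · obtain ⟨n, hn, hn0⟩ := ((h ε hε).and (eventually_gt_atTop 0)).exists
    rw [zero_add]
    have hbdd : BddBelow (range fun N : ℕ+ =>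
        ⨆ i : I, ((A ∩ Ico i (i + ((N : ℕ) : I))).ncard : ℝ) / (N : ℕ)) :=
      ⟨0, by rintro _ ⟨N, rfl⟩; exact Real.iSup_nonneg (hnonneg N)⟩
    refine (ciInf_le hbdd ⟨n, hn0⟩).trans (ciSup_le fun i => ?_)
    rw [PNat.mk_coe, hcount, div_le_iff₀ (by exact_mod_cast hn0)]
    exact hn i
  -- If every window of length `N` had density at least `c > 0`, tiling `[0, M * N)` by such windows
  -- would contradict the bound with `c / 2` for large `M`.
  · by_contra! hc
    set c := ⨅ i : I, ((A ∩ Ico i (i + ((N : ℕ) : I))).ncard : ℝ) / (N : ℕ)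
    have hN : (0 : ℝ) < (N : ℕ) := by exact_mod_cast N.pos
    have hwin (i : I) : c * (N : ℕ) ≤
        ((Finset.range N).filter fun j : ℕ => i + (j : I) ∈ A).card := by
      rw [← le_div_iff₀ hN, ← hcount]
      exact ciInf_le ⟨0, by rintro _ ⟨i, rfl⟩; exact hnonneg N i⟩ i
    have hmul (M : ℕ) : c * ((M * N : ℕ) : ℝ) ≤
        ((Finset.range (M * N)).filter fun j : ℕ => (0 : I) + (j : I) ∈ A).card := by
      induction M with
      | zero => simp
      | succ M ih =>
        have hw := hwin ((M * N : ℕ) : I)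
        simp only [Finset.card_filter, Nat.cast_sum, zero_add] at ih hw ⊢
        rw [Nat.succ_mul, Finset.sum_range_add]
        push_cast at ih hw ⊢
        linarith
    have hev := (h (c / 2) (half_pos hc)).and (eventually_gt_atTop 0)
    obtain ⟨n₀, hn₀⟩ := eventually_atTop.1 hev
    have hge : n₀ ≤ (n₀ + 1) * (N : ℕ) := by nlinarith [N.pos]
    have h1 := (hmul (n₀ + 1)).trans ((hn₀ _ hge).1 0)
    have h2 : (0 : ℝ) < (((n₀ + 1) * N : ℕ) : ℝ) := by exact_mod_cast (hn₀ _ hge).2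
    nlinarith

-- The hypothesis `hIco` is the only order property needed, so one counting argument serves both `ℤ`
-- and `ℕ`.
open Classical in
theorem ncard_inter_Ico_eq {I : Type*} [AddMonoidWithOne I] [CharZero I] [IsLeftCancelAdd I]
    [Preorder I]
    (hIco : ∀ (i j : I) (n : ℕ), j ∈ Ico i (i + (n : I)) ↔ ∃ t < n, i + (t : I) = j)
    (A : Set I) (i : I) (n : ℕ) :
    (A ∩ Ico i (i + (n : I))).ncard =
      ((Finset.range n).filter fun j : ℕ => i + (j : I) ∈ A).card := by
  rw [← ncard_coe_finset, ← ncard_image_of_injective (f := fun j : ℕ => i + (j : I)) _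
    fun a b hab => by simpa using hab]
  congr 1
  ext j
  simp only [mem_inter_iff, hIco, mem_image, Finset.coe_filter, Finset.mem_range, mem_ofPred_eq]
  constructor
  · rintro ⟨hj, t, ht, rfl⟩
    exact ⟨t, ⟨ht, hj⟩, rfl⟩
  · rintro ⟨t, ⟨ht, hj⟩, rfl⟩
    exact ⟨hj, t, ht, rfl⟩

/-! ### Greedy decompositions -/

/-- Greedy selection of intervals: scanning from left to right, a position at which an admissible
interval starts is covered by such an interval, the other positions become filler. -/
theorem exists_greedy_cuts (P : ℕ → ℕ → Prop) (h : ∀ n, ∃ n' ≥ n, ∃ k, P n' k) :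
    ∃ a b : ℕ → ℕ, a 0 = 0 ∧ (∀ j, a j ≤ b j) ∧ (∀ j, ∃ k, P (b j) k ∧ a (j + 1) = b j + (k + 1)) ∧
      ∀ j n, a j ≤ n → n < b j → ∀ k, ¬ P n k := by
  classical
  have h' (n : ℕ) : ∃ n', n ≤ n' ∧ ∃ k, P n' k := h n
  let β (n : ℕ) : ℕ := Nat.find (h' n)
  have hβ (n : ℕ) : n ≤ β n ∧ ∃ k, P (β n) k := Nat.find_spec (h' n)
  have hmin (n n' : ℕ) (hn' : n' < β n) : ¬(n ≤ n' ∧ ∃ k, P n' k) := Nat.find_min (h' n) hn'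
  choose κ hκ using fun n => (hβ n).2
  let a : ℕ → ℕ := fun j => Nat.rec 0 (fun _ n => β n + (κ n + 1)) j
  refine ⟨a, fun j => β (a j), rfl, fun j => (hβ _).1, fun j => ⟨κ (a j), hκ _, rfl⟩, ?_⟩
  intro j n hn hlt k hk
  exact hmin (a j) n hlt ⟨hn, k, hk⟩

open Classical in
/-- The positions without long `U`-blocks have density zero, uniformly on the windows of a single
element `y`, if `X` is invariant under the translations by the elements of the index set. -/
theorem eventually_card_window_nonErgodicPositions_le {Λ I : Type*} [Fintype Λ]
    [TopologicalSpace Λ] [DiscreteTopology Λ] [MeasurableSpace Λ] [BorelSpace Λ]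
    [AddCommMonoidWithOne I] [Countable I] {X : Set (I → Λ)} (hXc : IsClosed X)
    (hX : MapsTo shift X X) (htr : ∀ (i : I), ∀ x ∈ X, (fun j => x (i + j)) ∈ X)
    {U : Set (BlockOrMeasure X)} (hU : IsOpen U)
    (hUerg : ∀ μ ∈ ergodicMeasures X hX, BlockOrMeasure.measure μ ∈ U) (m : ℕ)
    {s : ℕ → I} (hs : ∀ k, ∃ n : ℕ, (n : I) + s k = 0) (y : X) {ε : ℝ} (hε : 0 < ε) :
    ∀ᶠ n : ℕ in atTop, ∀ i : I,
      (((Finset.range n).filter fun j : ℕ => i + (j : I) ∈ nonErgodicPositions U m s y).card : ℝ)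
        ≤ ε * n := by
  filter_upwards [eventually_card_nonErgodicPositions_le hXc hX hU hUerg m hs hε] with n hn i
  -- A window of `y` at `i` is the initial window of a translate of `y`, so uniformity over `X`
  -- becomes uniformity over `i`.
  refine le_trans (le_of_eq ?_) (hn ⟨_, htr i y y.2⟩)
  congr 2
  exact Finset.filter_congr fun j _ =>
    (mem_nonErgodicPositions_of_translate (fun _ => rfl) (j : I)).symm

open Classical in
/-- The complement of a set of density zero is syndetic. -/
theorem exists_forall_exists_add_notMem {I : Type*} [AddMonoidWithOne I] {A : Set I}
    (h : ∀ ε : ℝ, 0 < ε → ∀ᶠ n : ℕ in atTop, ∀ i : I,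
      (((Finset.range n).filter fun j : ℕ => i + (j : I) ∈ A).card : ℝ) ≤ ε * n) :
    ∃ n : ℕ, ∀ i : I, ∃ j < n, i + (j : I) ∉ A := by
  obtain ⟨n, hn, hn0⟩ := ((h (1 / 2) (by norm_num)).and (eventually_gt_atTop 0)).exists
  refine ⟨n, fun i => ?_⟩
  by_contra! hall
  have h1 := hn i
  rw [Finset.filter_true_of_mem fun j hj => hall j (Finset.mem_range.1 hj), Finset.card_range] at h1
  have h2 : (0 : ℝ) < n := by exact_mod_cast hn0
  linarith

theorem isErgodicOn_of_block_mem {Λ I : Type*} [AddMonoidWithOne I] [MeasurableSpace Λ]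
    {X : Set (I → Λ)} {U : Set (BlockOrMeasure X)} {m k : ℕ} {y : X} {i t : I}
    (hm : m ≤ k + 1) (h : BlockOrMeasure.block (blockAt y i k) ∈ U)
    (ht : t = i + ((k + 1 : ℕ) : I)) : IsErgodicOn U m (y : I → Λ) i t :=
  ⟨blockAt y i k, h, hm, ht, rfl⟩

/-- The greedy decomposition to the right of the origin. -/
theorem exists_isRightDecomposition {Λ I : Type*} [AddMonoidWithOne I] [Preorder I]
    (hmono : Monotone (Nat.cast : ℕ → I))
    [MeasurableSpace Λ] {X : Set (I → Λ)} {U : Set (BlockOrMeasure X)} {m : ℕ} {y : X}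
    (h : ∀ n : ℕ, ∃ n' ≥ n, (n' : I) ∉ nonErgodicPositions U m 0 y) :
    ∃ a b : ℕ → ℕ, IsRightDecomposition U m (y : I → Λ) (fun j => (a j : I)) (fun j => (b j : I)) ∧
      ∀ j n, a j ≤ n → n < b j → (n : I) ∈ nonErgodicPositions U m 0 y := by
  obtain ⟨a, b, h0, hab, herg, hfill⟩ := exists_greedy_cuts
    (fun n k => m ≤ k + 1 ∧ BlockOrMeasure.block (blockAt y (n : I) k) ∈ U) fun n => by
      obtain ⟨n', hn', hg⟩ := h n
      simp only [mem_nonErgodicPositions, Pi.zero_apply, add_zero] at hg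
      push Not at hg
      exact ⟨n', hn', hg⟩
  refine ⟨a, b, ⟨by simp [h0], fun j => hmono (hab j), fun j => ?_⟩, fun j n h1 h2 k hk hU => ?_⟩
  · obtain ⟨k, ⟨hm, hk⟩, he⟩ := herg j
    exact isErgodicOn_of_block_mem hm hk (by rw [he, Nat.cast_add])
  · rw [Pi.zero_apply, add_zero] at hU
    exact hfill j n h1 h2 k ⟨hk, hU⟩

/-- The greedy decomposition to the left of the origin. -/
theorem exists_isLeftDecomposition {Λ : Type*} [MeasurableSpace Λ] {X : Set (ℤ → Λ)}
    {U : Set (BlockOrMeasure X)} {m : ℕ} {y : X}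
    (h : ∀ n : ℕ, ∃ n' ≥ n, -(n' : ℤ) - 1 ∉ nonErgodicPositions U m (fun k => -(k : ℤ)) y) :
    ∃ a b : ℕ → ℕ,
      IsLeftDecomposition U m (y : ℤ → Λ) (fun j => -(a j : ℤ)) (fun j => -(b j : ℤ)) ∧
      ∀ j n, a j ≤ n → n < b j →
        -(n : ℤ) - 1 ∈ nonErgodicPositions U m (fun k => -(k : ℤ)) y := by
  -- Reflection sends `n` to the coordinate `-n - 1`; a block of length `k + 1` whose last
  -- coordinate is `-n - 1` starts at `-n - 1 - k`.
  obtain ⟨a, b, h0, hab, herg, hfill⟩ := exists_greedy_cuts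
    (fun n k => m ≤ k + 1 ∧ BlockOrMeasure.block (blockAt y (-(n : ℤ) - 1 + -(k : ℤ)) k) ∈ U)
    fun n => by
      obtain ⟨n', hn', hg⟩ := h n
      simp only [mem_nonErgodicPositions] at hg
      push Not at hg
      exact ⟨n', hn', hg⟩
  refine ⟨a, b, ⟨by simp [h0], fun j => by simpa using hab j, fun j => ?_⟩,
    fun j n h1 h2 k hk hU => hfill j n h1 h2 k ⟨hk, hU⟩⟩
  obtain ⟨k, ⟨hm, hk⟩, he⟩ := herg j
  have hs : -(a (j + 1) : ℤ) = -(b j : ℤ) - 1 + -(k : ℤ) := by rw [he]; push_cast; ring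
  rw [hs]
  exact isErgodicOn_of_block_mem hm hk (by push_cast; ring)

theorem IsTwoSided.translate_mem {Λ : Type*} [TopologicalSpace Λ] {X : Set (ℤ → Λ)}
    (hX : IsTwoSided X) (i : ℤ) : ∀ x ∈ X, (fun j => x (i + j)) ∈ X := by
  induction i using Int.induction_on with
  | zero => simp
  | succ n ih =>
    intro x hx
    have h : shift (fun j => x (n + j)) ∈ X := hX.mapsTo (ih x hx)
    convert h using 1
    funext j
    simp only [shift]
    congr 1
    ring
  | pred n ih =>
    intro x hx
    -- Backward translation needs surjectivity of the shift on `X`; a two-sided preimage is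
    -- determined by its image, hence is the desired translate.
    have hy : (fun j => x (-n + j)) ∈ shift '' X := hX.image_eq.symm ▸ ih x hx
    obtain ⟨z, hz, hzx⟩ := hy
    convert hz using 1
    funext j
    have h := congrFun hzx (j - 1)
    simp only [shift, sub_add_cancel] at h
    rw [h]
    congr 1
    ring

theorem IsOneSided.translate_mem {Λ : Type*} [TopologicalSpace Λ] {X : Set (ℕ → Λ)}
    (hX : IsOneSided X) (i : ℕ) : ∀ x ∈ X, (fun j => x (i + j)) ∈ X := by
  intro x hx
  have h := hX.mapsTo.iterate i hx
  convert h using 1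
  funext j
  rw [iterate_shift_apply, Nat.cast_id]

end Subshift

/-! ### Assembly of the two cases -/

theorem theorem2p6 {Λ : Type*} [Fintype Λ] [TopologicalSpace Λ] [DiscreteTopology Λ]
    [MeasurableSpace Λ] [BorelSpace Λ] :
    (∀ (X : Set (ℤ → Λ)) (hX : Subshift.IsTwoSided X) (U : Set (Subshift.BlockOrMeasure X)),
      IsOpen U →
      (∀ μ ∈ Subshift.ergodicMeasures X hX.mapsTo, Subshift.BlockOrMeasure.measure μ ∈ U) →
      ∀ (m : ℕ), ∀ x ∈ X, ∃ a b a' b' : ℕ → ℤ,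
        Subshift.IsRightDecomposition U m x a b ∧
        Subshift.IsLeftDecomposition U m x a' b' ∧
        Subshift.HasBanachDensity
          ((⋃ j, Set.Ico (a j) (b j)) ∪ ⋃ j, Set.Ico (b' j) (a' j)) 0) ∧
    (∀ (X : Set (ℕ → Λ)) (hX : Subshift.IsOneSided X) (U : Set (Subshift.BlockOrMeasure X)),
      IsOpen U →
      (∀ μ ∈ Subshift.ergodicMeasures X hX.mapsTo, Subshift.BlockOrMeasure.measure μ ∈ U) →
      ∀ (m : ℕ), ∀ x ∈ X, ∃ a b : ℕ → ℕ,
        Subshift.IsRightDecomposition U m x a b ∧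
        Subshift.HasBanachDensity (⋃ j, Set.Ico (a j) (b j)) 0) := by
  classical
  refine ⟨fun X hX U hU hUerg m x hx => ?_, fun X hX U hU hUerg m x hx => ?_⟩
  · have hR := fun (ε : ℝ) (hε : 0 < ε) =>
      Subshift.eventually_card_window_nonErgodicPositions_le hX.isClosed hX.mapsTo
        hX.translate_mem hU hUerg m (s := 0) (fun k => ⟨0, by simp⟩) ⟨x, hx⟩ hε
    have hL := fun (ε : ℝ) (hε : 0 < ε) =>
      Subshift.eventually_card_window_nonErgodicPositions_le hX.isClosed hX.mapsTo
        hX.translate_mem hU hUerg m (s := fun k => -(k : ℤ)) (fun k => ⟨k, by simp⟩) ⟨x, hx⟩ hε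
    set R := Subshift.nonErgodicPositions U m (0 : ℕ → ℤ) ⟨x, hx⟩
    set L := Subshift.nonErgodicPositions U m (fun k => -(k : ℤ)) ⟨x, hx⟩
    obtain ⟨N, hN⟩ := Subshift.exists_forall_exists_add_notMem hR
    obtain ⟨a, b, hab, hfill⟩ := Subshift.exists_isRightDecomposition (U := U) (m := m)
      (y := ⟨x, hx⟩) (I := ℤ) Nat.mono_cast fun n => by
        obtain ⟨j, -, hj⟩ := hN (n : ℤ)
        exact ⟨n + j, by omega, by rwa [Nat.cast_add]⟩
    obtain ⟨N', hN'⟩ := Subshift.exists_forall_exists_add_notMem hL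
    obtain ⟨a', b', hab', hfill'⟩ := Subshift.exists_isLeftDecomposition (U := U) (m := m)
      (y := ⟨x, hx⟩) fun n => by
        -- The window `[-n - N', -n)` consists of the reflections of `n, …, n + N' - 1`, so a good
        -- position in it has a reflected index at least `n`.
        obtain ⟨j, hjN, hj⟩ := hN' (-(n : ℤ) - N')
        refine ⟨n + (N' - 1 - j), by omega, ?_⟩
        rwa [show -((n + (N' - 1 - j) : ℕ) : ℤ) - 1 = -(n : ℤ) - N' + j by omega]
    refine ⟨_, _, _, _, hab, hab', ?_⟩
    have hsub : ((⋃ j, Ico (a j : ℤ) (b j)) ∪ ⋃ j, Ico (-(b' j : ℤ)) (-(a' j : ℤ))) ⊆ R ∪ L := by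
      rintro z (hz | hz)
      · obtain ⟨j, h1, h2⟩ := mem_iUnion.1 hz
        lift z to ℕ using by omega
        exact Or.inl (hfill j z (by omega) (by omega))
      · obtain ⟨j, h1, h2⟩ := mem_iUnion.1 hz
        obtain ⟨n, rfl⟩ : ∃ n : ℕ, z = -(n : ℤ) - 1 := ⟨(-z - 1).toNat, by omega⟩
        exact Or.inr (hfill' j n (by omega) (by omega))
    generalize ((⋃ j, Ico (a j : ℤ) (b j)) ∪ ⋃ j, Ico (-(b' j : ℤ)) (-(a' j : ℤ))) = M at hsub ⊢
    refine Subshift.hasBanachDensity_zero (Subshift.ncard_inter_Ico_eq (fun i j n => ?_) _)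
      fun ε hε => ?_
    · rw [mem_Ico]
      exact ⟨fun h => ⟨(j - i).toNat, by omega, by omega⟩, by rintro ⟨t, ht, rfl⟩; omega⟩
    -- The filler lies in `R ∪ L`, and each of the two sets receives half of `ε`.
    · filter_upwards [hR (ε / 2) (half_pos hε), hL (ε / 2) (half_pos hε)] with n h1 h2 i
      refine le_trans (Nat.cast_le.2 ((Finset.card_le_card
        (t := (Finset.range n).filter (fun j : ℕ => i + (j : ℤ) ∈ R) ∪
          (Finset.range n).filter fun j : ℕ => i + (j : ℤ) ∈ L) fun j hj => ?_).trans
        (Finset.card_union_le _ _))) ?_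
      · rw [Finset.mem_filter] at hj
        rw [Finset.mem_union, Finset.mem_filter, Finset.mem_filter]
        exact (hsub hj.2).imp (⟨hj.1, ·⟩) (⟨hj.1, ·⟩)
      · have h3 := h1 i
        have h4 := h2 i
        push_cast
        linarith
  · have hR := fun (ε : ℝ) (hε : 0 < ε) =>
      Subshift.eventually_card_window_nonErgodicPositions_le hX.isClosed hX.mapsTo
        hX.translate_mem hU hUerg m (s := 0) (fun k => ⟨0, by simp⟩) ⟨x, hx⟩ hε
    obtain ⟨N, hN⟩ := Subshift.exists_forall_exists_add_notMem hR
    obtain ⟨a, b, hab, hfill⟩ := Subshift.exists_isRightDecomposition (U := U) (m := m)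
      (y := ⟨x, hx⟩) (I := ℕ) Nat.mono_cast fun n => by
        obtain ⟨j, -, hj⟩ := hN n
        exact ⟨n + j, by omega, hj⟩
    refine ⟨_, _, hab, ?_⟩
    refine Subshift.hasBanachDensity_zero (Subshift.ncard_inter_Ico_eq (fun i j n => ?_) _)
      fun ε hε => ?_
    · rw [mem_Ico, Nat.cast_id]
      exact ⟨fun h => ⟨j - i, by omega, by simp; omega⟩, by rintro ⟨t, ht, rfl⟩; simp; omega⟩
    · filter_upwards [hR ε hε] with n h1 i
      refine le_trans (Nat.cast_le.2 (Finset.card_le_card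
        (Finset.monotone_filter_right (Finset.range n) fun j _ hj => ?_))) (h1 i)
      obtain ⟨t, ht1, ht2⟩ := mem_iUnion.1 hj
      exact hfill t _ ht1 ht2
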